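/- All rings are commutative with identity and all modules are unital. A ring $R$ is a $\phi$-ring if its nilradical $\mathrm{Nil}(R)$ is a divided prime ideal, i.e. $\mathrm{Nil}(R)$ is prime and $\mathrm{Nil}(R)\subsetneq (x)$ for every $x\in R\setminus \mathrm{Nil}(R)$. An ideal is nonnil if it is not contained in $\mathrm{Nil}(R)$. A $\phi$-ring $R$ is nonnil-coherent if every finitely generated nonnil ideal of $R$ is finitely presented. An $R$-module $M$ is - $\phi$-torsion if for every $x\in M$ there is a nonnil ideal $I$ of $R$ with $Ix=0$; - $\phi$-flat if $\mathrm{Tor}_1^R(T,M)=0$ for every $\phi$-torsion $R$-module $T$; - nonnil-injective if $\mathrm{Ext}^1_R(T,M)=0$ for every $\phi$-torsion $R$-module $T$; - nonnil-FP-injective if $\mathrm{Ext}^1_R(T,M)=0$ for every finitely presented $\phi$-torsion $R$-module $T$; - $\phi$-copure flat if $\mathrm{Tor}_1^R(E,M)=0$ for every nonnil-injective $R$-module $E$. A $\phi$-embedding is an injective $R$-linear map $f\colon N\to M$ such that $M/f(N)$ is $\phi$-torsion. A $\phi$-ring $R$ is a $\phi$-IF ring if every nonnil-injective $R$-module is $\phi$-flat.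 **Theorem.** Let $R$ be a $\phi$-ring. The following statements are equivalent: 1. $R$ is a $\phi$-IF ring; 2. $R$ is nonnil-coherent and the localization $R_{\mathfrak p}$ is a $\phi$-IF ring for every prime ideal $\mathfrak p$ of $R$; 3. $R$ is nonnil-coherent and the localization $R_{\mathfrak m}$ is a $\phi$-IF ring for every maximal ideal $\mathfrak m$ of $R$; 4. for every $R$-module $M$ there is a $\phi$-embedding of $M$ into a $\phi$-flat $R$-module; 5. every nonnil-FP-injective $R$-module is $\phi$-flat; 6. $R$ is nonnil-coherent and every $\phi$-flat $R$-module is nonnil-FP-injective; 7. an $R$-module is $\phi$-flat if and only if it is nonnil-FP-injective; 8. every $\phi$-torsion $R$-module is $\phi$-copure flat; 9. $R/\mathrm{Nil}(R)$ is a field. -/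

import Mathlib

open CategoryTheory

universe u

/-- An ideal `I` of `R` is nonnil if it is not contained in the nilradical of `R`. -/
def Ideal.IsNonnil {R : Type u} [CommRing R] (I : Ideal R) : Prop :=
  ¬ I ≤ nilradical R

/-- A `φ`-ring: the nilradical is a divided prime ideal, that is, it is prime and it is properly
contained in every principal ideal generated by an element outside of it. -/
structure IsPhiRing (R : Type u) [CommRing R] : Prop where
  isPrime : (nilradical R).IsPrime
  divided : ∀ x : R, x ∉ nilradical R → nilradical R < Ideal.span {x}

/-- A `φ`-ring is nonnil-coherent if each finitely generated nonnil ideal is finitely presented. -/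
structure IsNonnilCoherent (R : Type u) [CommRing R] : Prop where
  isPhiRing : IsPhiRing R
  finitePresentation : ∀ I : Ideal R, I.IsNonnil → I.FG → Module.FinitePresentation R I

section Modules

variable (R : Type u) [CommRing R] (M : Type u) [AddCommGroup M] [Module R M]

/-- `M` is `φ`-torsion if every element of `M` is annihilated by a nonnil ideal. -/
def IsPhiTorsion : Prop :=
  ∀ x : M, ∃ I : Ideal R, I.IsNonnil ∧ ∀ a ∈ I, a • x = 0

/-- `M` is `φ`-flat if `Tor₁(T, M) = 0` for each `φ`-torsion module `T`. -/
def IsPhiFlat : Prop :=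
  ∀ (T : Type u) [AddCommGroup T] [Module R T], IsPhiTorsion R T →
    Limits.IsZero (((Tor (ModuleCat.{u} R) 1).obj (ModuleCat.of R T)).obj (ModuleCat.of R M))

/-- `M` is nonnil-injective if `Ext¹(T, M) = 0` for each `φ`-torsion module `T`. -/
def IsNonnilInjective : Prop :=
  ∀ (T : Type u) [AddCommGroup T] [Module R T], IsPhiTorsion R T →
    Subsingleton (Abelian.Ext.{u} (ModuleCat.of R T) (ModuleCat.of R M) 1)

/-- `M` is nonnil-FP-injective if `Ext¹(T, M) = 0` for each finitely presented `φ`-torsion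
module `T`. -/
def IsNonnilFPInjective : Prop :=
  ∀ (T : Type u) [AddCommGroup T] [Module R T], Module.FinitePresentation R T →
    IsPhiTorsion R T →
      Subsingleton (Abelian.Ext.{u} (ModuleCat.of R T) (ModuleCat.of R M) 1)

/-- `M` is `φ`-copure flat if `Tor₁(E, M) = 0` for each nonnil-injective module `E`. -/
def IsPhiCopureFlat : Prop :=
  ∀ (E : Type u) [AddCommGroup E] [Module R E], IsNonnilInjective R E →
    Limits.IsZero (((Tor (ModuleCat.{u} R) 1).obj (ModuleCat.of R E)).obj (ModuleCat.of R M))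

end Modules

/-- A `φ`-embedding: an injective linear map whose cokernel is `φ`-torsion. -/
structure IsPhiEmbedding {R : Type u} [CommRing R] {N M : Type u} [AddCommGroup N] [Module R N]
    [AddCommGroup M] [Module R M] (f : N →ₗ[R] M) : Prop where
  injective : Function.Injective f
  isPhiTorsion : IsPhiTorsion R (M ⧸ LinearMap.range f)

/-- A `φ`-ring is a `φ`-IF ring if every nonnil-injective module is `φ`-flat. -/
structure IsPhiIFRing (R : Type u) [CommRing R] : Prop where
  isPhiRing : IsPhiRing R
  isPhiFlat : ∀ (M : Type u) [AddCommGroup M] [Module R M],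
    IsNonnilInjective R M → IsPhiFlat R M

/-! Each condition amounts to every non-nilpotent `x` being a unit, which for a `φ`-ring is
condition 9. If that holds, `φ`-torsion modules are zero and the homological conditions are vacuous.

Conversely, write N for the nilradical. Dividedness gives N = sN for `s` outside N, so N kills every
`φ`-torsion module. Given `x` outside N, embed R/(x) in an injective Q; the part E of Q killed by N
is nonnil-injective and contains an element e with annihilator (x). In a `φ`-flat F, however, `x • e
= 0` forces e into N·F (`IsPhiFlat.mem_nilradical_smul_top`). So if E is `φ`-flat then e = 0 and `x`
is a unit. Conditions 4 and 8 use variants of this clash; condition 6 uses the `φ`-flat module R/N,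
and condition 3 descends from localizations. -/

/-! ### Vanishing of Ext¹ as extension of maps -/

section Ext

variable {R : Type u} [CommRing R] {K P T : Type u} [AddCommGroup K] [Module R K]
  [AddCommGroup P] [Module R P] [AddCommGroup T] [Module R T] {i : K →ₗ[R] P} {q : P →ₗ[R] T}

/-- The short exact sequence of module objects attached to a presentation. -/
theorem shortExact_ofHom (hi : Function.Injective i) (hiq : Function.Exact i q)
    (hq : Function.Surjective q) :
    (ShortComplex.mk (ModuleCat.ofHom i) (ModuleCat.ofHom q) (by
      ext x; exact hiq.apply_apply_eq_zero x)).ShortExact where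
  exact := (ShortComplex.ShortExact.moduleCat_exact_iff_function_exact _).mpr hiq
  mono_f := (ModuleCat.mono_iff_injective _).mpr hi
  epi_g := (ModuleCat.epi_iff_surjective _).mpr hq

theorem exists_extension_of_subsingleton_ext (hi : Function.Injective i)
    (hiq : Function.Exact i q) (hq : Function.Surjective q) (E : Type u) [AddCommGroup E]
    [Module R E] (h : Subsingleton (Abelian.Ext.{u} (ModuleCat.of R T) (ModuleCat.of R E) 1))
    (f : K →ₗ[R] E) : ∃ g : P →ₗ[R] E, g ∘ₗ i = f := by
  have hS := shortExact_ofHom hi hiq hq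
  obtain ⟨g, hg⟩ := Abelian.Ext.contravariant_sequence_exact₁ hS (ModuleCat.of R E)
    (Abelian.Ext.mk₀.{u} (ModuleCat.ofHom f)) (n₁ := 1) rfl (Subsingleton.elim _ _)
  obtain ⟨g, rfl⟩ := Abelian.Ext.addEquiv₀.symm.surjective g
  refine ⟨g.hom, ?_⟩
  simp only [Abelian.Ext.addEquiv₀_symm_apply, Abelian.Ext.mk₀_comp_mk₀] at hg
  have := Abelian.Ext.mk₀_bijective _ _ |>.1 hg
  exact congrArg ModuleCat.Hom.hom this

theorem subsingleton_ext_of_exists_extension [Module.Projective R P] (hi : Function.Injective i)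
    (hiq : Function.Exact i q) (hq : Function.Surjective q) (E : Type u) [AddCommGroup E]
    [Module R E] (h : ∀ f : K →ₗ[R] E, ∃ g : P →ₗ[R] E, g ∘ₗ i = f) :
    Subsingleton (Abelian.Ext.{u} (ModuleCat.of R T) (ModuleCat.of R E) 1) := by
  have hS := shortExact_ofHom hi hiq hq
  refine subsingleton_of_forall_eq 0 fun e => ?_
  have : Projective (ModuleCat.of R P) := (IsProjective.iff_projective _).mp inferInstance
  obtain ⟨f, rfl⟩ := Abelian.Ext.contravariant_sequence_exact₃ hS (ModuleCat.of R E) e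
    (Abelian.Ext.eq_zero_of_projective _) (n₀ := 0) rfl
  obtain ⟨f, rfl⟩ := Abelian.Ext.addEquiv₀.symm.surjective f
  obtain ⟨g, hg⟩ := h f.hom
  have hfg : f = ModuleCat.ofHom i ≫ ModuleCat.ofHom g := by
    ext x; exact (LinearMap.congr_fun hg x).symm
  rw [Abelian.Ext.addEquiv₀_symm_apply, hfg, ← Abelian.Ext.mk₀_comp_mk₀]
  exact hS.extClass_comp_assoc (Abelian.Ext.mk₀ (ModuleCat.ofHom g))

end Ext

/-! ### Vanishing of Tor₁ read off a presentation -/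

section Tor

variable {R : Type u} [CommRing R] (T : Type u) [AddCommGroup T] [Module R T]

/-- Compare the presentations by lifts α, β of the identity of M. Since βα is homotopic to the
identity, `id = β' ∘ α' + s ∘ i` on K; after tensoring, both terms kill any element of the kernel.
-/
theorem lTensor_injective_of_presentation {K P K' P' M : Type u} [AddCommGroup K] [Module R K]
    [AddCommGroup P] [Module R P] [AddCommGroup K'] [Module R K'] [AddCommGroup P'] [Module R P']
    [AddCommGroup M] [Module R M] [Module.Projective R P] [Module.Projective R P']
    {i : K →ₗ[R] P} {q : P →ₗ[R] M} {i' : K' →ₗ[R] P'} {q' : P' →ₗ[R] M}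
    (hi : Function.Injective i) (hiq : Function.Exact i q) (hq : Function.Surjective q)
    (hi' : Function.Injective i') (hiq' : Function.Exact i' q') (hq' : Function.Surjective q')
    (h : Function.Injective (i'.lTensor T)) : Function.Injective (i.lTensor T) := by
  have lift : ∀ {A B C : Type u} [AddCommGroup A] [Module R A] [AddCommGroup B] [Module R B]
      [AddCommGroup C] [Module R C] {j : B →ₗ[R] C} {p : C →ₗ[R] M} (_ : Function.Injective j)
      (_ : Function.Exact j p) (f : A →ₗ[R] C) (_ : p ∘ₗ f = 0),
      ∃ g : A →ₗ[R] B, j ∘ₗ g = f := by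
    intro A B C _ _ _ _ _ _ j p hj hjp f hf
    have hr : ∀ a, f a ∈ LinearMap.range j := fun a => (hjp _).mp (LinearMap.congr_fun hf a)
    refine ⟨(LinearEquiv.ofInjective j hj).symm ∘ₗ f.codRestrict _ hr, ?_⟩
    ext a
    exact congrArg Subtype.val ((LinearEquiv.ofInjective j hj).apply_symm_apply ⟨f a, hr a⟩)
  obtain ⟨α, hα⟩ := Module.projective_lifting_property q' q hq'
  obtain ⟨β, hβ⟩ := Module.projective_lifting_property q q' hq
  obtain ⟨α', hα'⟩ := lift hi' hiq' (α ∘ₗ i) (by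
    rw [← LinearMap.comp_assoc, hα]; exact hiq.linearMap_comp_eq_zero)
  obtain ⟨β', hβ'⟩ := lift hi hiq (β ∘ₗ i') (by
    rw [← LinearMap.comp_assoc, hβ]; exact hiq'.linearMap_comp_eq_zero)
  obtain ⟨s, hs⟩ := lift hi hiq (LinearMap.id - β ∘ₗ α) (by
    rw [LinearMap.comp_sub, ← LinearMap.comp_assoc, hβ, hα]; simp)
  have key : LinearMap.id = β' ∘ₗ α' + s ∘ₗ i := by
    ext k
    apply hi
    have h1 := LinearMap.congr_fun hα' k
    have h2 := LinearMap.congr_fun hβ' (α' k)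
    have h3 := LinearMap.congr_fun hs (i k)
    simp only [LinearMap.comp_apply, LinearMap.sub_apply, LinearMap.id_apply] at h1 h2 h3
    simp [h2, h3, h1]
  rw [injective_iff_map_eq_zero]
  intro z hz
  have h1 : α'.lTensor T z = 0 := by
    apply h
    rw [← LinearMap.comp_apply, ← LinearMap.lTensor_comp, hα', LinearMap.lTensor_comp,
      LinearMap.comp_apply, hz, map_zero, map_zero]
  have h2 := LinearMap.congr_fun (congrArg (LinearMap.lTensor T) key) z
  simpa [LinearMap.lTensor_add, LinearMap.lTensor_comp, h1, hz] using h2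

/-- `Tor` is derived in its second argument, so it is M that gets resolved. -/
theorem isZero_tor_one_iff_exact {M : ModuleCat.{u} R} (Q : ProjectiveResolution M) :
    Limits.IsZero (((Tor (ModuleCat.{u} R) 1).obj (ModuleCat.of R T)).obj M) ↔
      Function.Exact ((Q.complex.d 2 1).hom.lTensor T) ((Q.complex.d 1 0).hom.lTensor T) := by
  let F := (MonoidalCategory.tensoringLeft (ModuleCat.{u} R)).obj (ModuleCat.of R T)
  let C := (F.mapHomologicalComplex (ComplexShape.down ℕ)).obj Q.complex
  have e := Q.isoLeftDerivedObj F 1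
  have h1 : Limits.IsZero (((Tor (ModuleCat.{u} R) 1).obj (ModuleCat.of R T)).obj M) ↔
      Limits.IsZero (C.homology 1) := e.isZero_iff
  rw [h1, ← HomologicalComplex.exactAt_iff_isZero_homology,
    C.exactAt_iff' 2 1 0 (by simp) (by simp),
    ShortComplex.ShortExact.moduleCat_exact_iff_function_exact]
  rfl

/-- `Tor₁(T, M)` vanishes iff `T ⊗ K → T ⊗ P` is injective, for a presentation
`0 → K → P → M → 0` with `P` projective. -/
theorem isZero_tor_one_iff {K P M : Type u} [AddCommGroup K] [Module R K]
    [AddCommGroup P] [Module R P] [AddCommGroup M] [Module R M] [Module.Projective R P]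
    {i : K →ₗ[R] P} {q : P →ₗ[R] M}
    (hi : Function.Injective i) (hiq : Function.Exact i q) (hq : Function.Surjective q) :
    Limits.IsZero (((Tor (ModuleCat.{u} R) 1).obj (ModuleCat.of R T)).obj (ModuleCat.of R M)) ↔
      Function.Injective (i.lTensor T) := by
  let Q := ProjectiveResolution.of (ModuleCat.of R M)
  rw [isZero_tor_one_iff_exact T Q]
  let d₂ : Q.complex.X 2 →ₗ[R] Q.complex.X 1 := (Q.complex.d 2 1).hom
  let d₁ : Q.complex.X 1 →ₗ[R] Q.complex.X 0 := (Q.complex.d 1 0).hom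
  let π : Q.complex.X 0 →ₗ[R] M := (Q.π.f 0).hom
  have hπ : Function.Surjective π := (ModuleCat.epi_iff_surjective (Q.π.f 0)).mp inferInstance
  have hd₁ : Function.Exact d₁ π :=
    (ShortComplex.ShortExact.moduleCat_exact_iff_function_exact _).mp Q.exact₀
  have hd₂ : Function.Exact d₂ d₁ :=
    (ShortComplex.ShortExact.moduleCat_exact_iff_function_exact _).mp (Q.exact_succ 0)
  have : Module.Projective R (Q.complex.X 0) :=
    (IsProjective.iff_projective _).mpr (Q.projective 0)
  have hK : Function.Exact (LinearMap.range d₁).subtype π := by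
    rw [LinearMap.exact_iff] at hd₁ ⊢
    rw [hd₁, Submodule.range_subtype]
  have hd₂' : Function.Exact d₂ d₁.rangeRestrict := by
    rw [LinearMap.exact_iff] at hd₂ ⊢
    rw [LinearMap.ker_rangeRestrict, hd₂]
  have hsurj : Function.Surjective d₁.rangeRestrict := d₁.surjective_rangeRestrict
  have hex := lTensor_exact T hd₂' hsurj
  have hfac : d₁.lTensor T = (LinearMap.range d₁).subtype.lTensor T ∘ₗ d₁.rangeRestrict.lTensor T :=
    by rw [← LinearMap.lTensor_comp]; rfl
  have hts := LinearMap.lTensor_surjective T hsurj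
  have step : Function.Exact (d₂.lTensor T) (d₁.lTensor T) ↔
      Function.Injective ((LinearMap.range d₁).subtype.lTensor T) := by
    rw [hfac]
    constructor
    · intro h
      rw [injective_iff_map_eq_zero]
      intro z hz
      obtain ⟨w, rfl⟩ := hts z
      exact (hex w).mpr ((h w).mp hz)
    · intro h w
      rw [← hex w, LinearMap.comp_apply, map_eq_zero_iff _ h]
  exact step.trans
    ⟨lTensor_injective_of_presentation T hi hiq hq Subtype.val_injective hK hπ,
      lTensor_injective_of_presentation T Subtype.val_injective hK hπ hi hiq hq⟩

end Tor

/-! ### φ-torsion, φ-flat and nonnil-injective modules over a φ-ring -/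

section PhiRing

variable {R : Type u} [CommRing R]

namespace IsPhiRing

theorem exists_eq_mul (hR : IsPhiRing R) {x n : R} (hx : x ∉ nilradical R)
    (hn : n ∈ nilradical R) : ∃ m ∈ nilradical R, n = x * m := by
  obtain ⟨m, rfl⟩ := Ideal.mem_span_singleton.mp ((hR.divided x hx).le hn)
  exact ⟨m, (hR.isPrime.mem_or_mem hn).resolve_left hx, rfl⟩

theorem mem_of_mul_eq_zero (hR : IsPhiRing R) {x a : R} (hx : x ∉ nilradical R)
    (h : a * x = 0) : a ∈ nilradical R :=
  (hR.isPrime.mem_or_mem (h ▸ Ideal.zero_mem _ : a * x ∈ nilradical R)).resolve_right hx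

end IsPhiRing

theorem isPhiTorsion_iff {M : Type u} [AddCommGroup M] [Module R M] :
    IsPhiTorsion R M ↔ ∀ m : M, ∃ s : R, s ∉ nilradical R ∧ s • m = 0 := by
  refine forall_congr' fun m => ⟨?_, ?_⟩
  · rintro ⟨I, hI, h⟩
    obtain ⟨s, hs, hsN⟩ := SetLike.not_le_iff_exists.mp hI
    exact ⟨s, hsN, h s hs⟩
  · rintro ⟨s, hs, h⟩
    refine ⟨Ideal.span {s}, fun hle => hs (hle (Ideal.mem_span_singleton_self s)), ?_⟩
    intro a ha
    obtain ⟨b, rfl⟩ := Ideal.mem_span_singleton'.mp ha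
    rw [mul_smul, h, smul_zero]

theorem isPhiTorsion_quotient_span_singleton {x : R} (hx : x ∉ nilradical R) :
    IsPhiTorsion R (R ⧸ Ideal.span {x}) := by
  rw [isPhiTorsion_iff]
  intro m
  obtain ⟨r, rfl⟩ := Ideal.Quotient.mk_surjective m
  refine ⟨x, hx, ?_⟩
  rw [Algebra.smul_def, Ideal.Quotient.algebraMap_eq, ← map_mul, Ideal.Quotient.eq_zero_iff_mem]
  exact Ideal.mul_mem_right _ _ (Ideal.mem_span_singleton_self x)

/-- If `P` maps to a `φ`-torsion module, then the nilradical multiplies `P` into its multiples of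
the kernel. -/
theorem IsPhiTorsion.nilradical_smul_top_le (hR : IsPhiRing R) {P T : Type u} [AddCommGroup P]
    [Module R P] [AddCommGroup T] [Module R T] (hT : IsPhiTorsion R T) (q : P →ₗ[R] T) :
    nilradical R • (⊤ : Submodule R P) ≤ nilradical R • LinearMap.ker q := by
  rw [Submodule.smul_le]
  intro n hn p _
  obtain ⟨s, hs, hsp⟩ := isPhiTorsion_iff.mp hT (q p)
  obtain ⟨m, hm, rfl⟩ := hR.exists_eq_mul hs hn
  -- With n = sm, n • p = m • (s • p), and s • p lies in the kernel.
  rw [mul_comm, mul_smul]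
  exact Submodule.smul_mem_smul hm (by rw [LinearMap.mem_ker, map_smul, hsp])

theorem IsPhiTorsion.nilradical_smul_top (hR : IsPhiRing R) {T : Type u} [AddCommGroup T]
    [Module R T] (hT : IsPhiTorsion R T) : nilradical R • (⊤ : Submodule R T) = ⊥ := by
  have := hT.nilradical_smul_top_le hR LinearMap.id
  rwa [LinearMap.ker_id, Submodule.smul_bot, le_bot_iff] at this

/-- In a `φ`-flat module, an element killed by a non-nilpotent scalar is a nilpotent combination. -/
theorem IsPhiFlat.mem_nilradical_smul_top (hR : IsPhiRing R) {F : Type u} [AddCommGroup F]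
    [Module R F] (hF : IsPhiFlat R F) {x : R} (hx : x ∉ nilradical R) {e : F} (he : x • e = 0) :
    e ∈ nilradical R • (⊤ : Submodule R F) := by
  let q : (F →₀ R) →ₗ[R] F := Finsupp.linearCombination R id
  have hq : Function.Surjective q := Finsupp.linearCombination_id_surjective R F
  have hinj := (isZero_tor_one_iff (R ⧸ Ideal.span {x}) (K := LinearMap.ker q) (P := F →₀ R)
    (LinearMap.ker q).subtype_injective (LinearMap.exact_subtype_ker_map q) hq).mp
      (hF _ (isPhiTorsion_quotient_span_singleton hx))
  let p : F →₀ R := Finsupp.single e 1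
  have hp : q p = e := by simp [q, p]
  let k₀ : LinearMap.ker q := ⟨x • p, by rw [LinearMap.mem_ker, map_smul, hp, he]⟩
  have hk₀ : (1 : R ⧸ Ideal.span {x}) ⊗ₜ[R] k₀ = 0 := by
    apply hinj
    rw [LinearMap.lTensor_tmul, map_zero]
    change (1 : R ⧸ Ideal.span {x}) ⊗ₜ[R] (x • p) = 0
    rw [← TensorProduct.smul_tmul, Algebra.smul_def, mul_one, Ideal.Quotient.algebraMap_eq,
      Ideal.Quotient.eq_zero_iff_mem.mpr (Ideal.mem_span_singleton_self x),
      TensorProduct.zero_tmul]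
  -- Injectivity has given xP ∩ K = xK at `x • p`: so `x • p = x • k` with k in K.
  have hmem : k₀ ∈ Ideal.span {x} • (⊤ : Submodule R (LinearMap.ker q)) := by
    have := congrArg (TensorProduct.quotTensorEquivQuotSMul (LinearMap.ker q) (Ideal.span {x})) hk₀
    rw [← map_one (Ideal.Quotient.mk (Ideal.span {x})),
      TensorProduct.quotTensorEquivQuotSMul_mk_tmul, map_zero, one_smul] at this
    exact (Submodule.Quotient.mk_eq_zero _).mp this
  rw [Submodule.ideal_span_singleton_smul] at hmem
  obtain ⟨k, -, hk⟩ := hmem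
  have hk' : x • (k : F →₀ R) = x • p := congrArg Subtype.val hk
  -- The coordinates of p - k are killed by x, hence nilpotent.
  have hdiff : e = q (p - k) := by
    rw [map_sub, hp, LinearMap.mem_ker.mp k.2, sub_zero]
  rw [hdiff, Finsupp.linearCombination_apply]
  refine Submodule.sum_mem _ fun j _ => Submodule.smul_mem_smul ?_ trivial
  refine hR.mem_of_mul_eq_zero hx ?_
  rw [mul_comm]
  have := DFunLike.congr_fun hk' j
  simp only [Finsupp.smul_apply, smul_eq_mul] at this
  rw [Finsupp.sub_apply, mul_sub, this, sub_self]

/-- As NP ⊆ NK for K = ker q, a map from K to a module killed by N factors through the image of K in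
P/NP. It extends to P/NP by injectivity of Q, and that extension has values killed by N. -/
theorem IsPhiTorsion.exists_extension_torsionBySet (hR : IsPhiRing R) {P T : Type u}
    [AddCommGroup P] [Module R P] [AddCommGroup T] [Module R T] (hT : IsPhiTorsion R T)
    (q : P →ₗ[R] T) (Q : Type u) [AddCommGroup Q] [Module R Q] [Module.Injective R Q]
    (f : LinearMap.ker q →ₗ[R] Submodule.torsionBySet R Q (nilradical R)) :
    ∃ g : P →ₗ[R] Submodule.torsionBySet R Q (nilradical R),
      g ∘ₗ (LinearMap.ker q).subtype = f := by
  let NP : Submodule R P := nilradical R • ⊤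
  let ρ : LinearMap.ker q →ₗ[R] P ⧸ NP := NP.mkQ ∘ₗ (LinearMap.ker q).subtype
  have hker : LinearMap.ker ρ ≤ LinearMap.ker f := by
    intro k hk
    have hk1 : (k : P) ∈ NP := (Submodule.Quotient.mk_eq_zero _).mp hk
    have hk2 := (Submodule.mem_smul_top_iff _ _ _).mpr (hT.nilradical_smul_top_le hR q hk1)
    revert hk2
    apply Submodule.smul_le.mpr
    intro n hn y _
    rw [LinearMap.mem_ker, map_smul]
    exact Subtype.ext ((Submodule.mem_torsionBySet_iff _ _).mp (f y).2 ⟨n, hn⟩)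
  let f' : LinearMap.ker q →ₗ[R] Q := (Submodule.torsionBySet R Q (nilradical R)).subtype ∘ₗ f
  obtain ⟨h, hh⟩ := Module.Injective.out ((LinearMap.ker ρ).liftQ ρ le_rfl)
    (LinearMap.ker_eq_bot.mp (Submodule.ker_liftQ_eq_bot' _ ρ rfl))
    ((LinearMap.ker ρ).liftQ f' (hker.trans (LinearMap.ker_le_ker_comp _ _)))
  refine ⟨(h ∘ₗ NP.mkQ).codRestrict _ ?_, ?_⟩
  · intro p
    rw [Submodule.mem_torsionBySet_iff]
    rintro ⟨n, hn⟩
    change n • (h ∘ₗ NP.mkQ) p = 0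
    rw [← map_smul, LinearMap.comp_apply]
    have : NP.mkQ (n • p) = 0 :=
      (Submodule.Quotient.mk_eq_zero _).mpr (Submodule.smul_mem_smul hn trivial)
    rw [this, map_zero]
  · ext k
    exact hh (Submodule.Quotient.mk k)

/-- The part of an injective module killed by the nilradical is nonnil-injective. -/
theorem isNonnilInjective_torsionBySet (hR : IsPhiRing R) (Q : Type u) [AddCommGroup Q]
    [Module R Q] [Module.Injective R Q] :
    IsNonnilInjective R (Submodule.torsionBySet R Q (nilradical R)) := by
  intro T _ _ hT
  let q : (T →₀ R) →ₗ[R] T := Finsupp.linearCombination R id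
  exact subsingleton_ext_of_exists_extension (K := LinearMap.ker q) (P := T →₀ R)
    (LinearMap.ker q).subtype_injective (LinearMap.exact_subtype_ker_map q)
    (Finsupp.linearCombination_id_surjective R T) _
    (hT.exists_extension_torsionBySet hR q Q)

/-- For `x` not nilpotent, some nonnil-injective module killed by the nilradical has an element
whose annihilator is `(x)`. -/
theorem exists_isNonnilInjective_killed (hR : IsPhiRing R) {x : R} (hx : x ∉ nilradical R) :
    ∃ (E : Type u) (_ : AddCommGroup E) (_ : Module R E) (e : E), IsNonnilInjective R E ∧
      nilradical R • (⊤ : Submodule R E) = ⊥ ∧ x • e = 0 ∧ (e = 0 → IsUnit x) := by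
  let M := ModuleCat.of R (R ⧸ Ideal.span {x})
  let Q := Injective.under M
  let ι : (R ⧸ Ideal.span {x}) →ₗ[R] Q := (Injective.ι M).hom
  have hι : Function.Injective ι := (ModuleCat.mono_iff_injective (Injective.ι M)).mp inferInstance
  have : Injective (ModuleCat.of R Q) := Injective.injective_under M
  have : Module.Injective R Q := Module.injective_module_of_injective_object R Q
  -- Since N ⊆ (x), this also places `ι 1` in the part of Q killed by N.
  have hone : ∀ a ∈ Ideal.span {x}, a • ι 1 = 0 := fun a ha => by
    rw [← map_smul, Algebra.smul_def, mul_one, Ideal.Quotient.algebraMap_eq,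
      Ideal.Quotient.eq_zero_iff_mem.mpr ha, map_zero]
  refine ⟨Submodule.torsionBySet R Q (nilradical R), inferInstance, inferInstance,
    ⟨ι 1, (Submodule.mem_torsionBySet_iff _ _).mpr fun n => hone n ((hR.divided x hx).le n.2)⟩,
    isNonnilInjective_torsionBySet hR Q, ?_, ?_, ?_⟩
  · rw [eq_bot_iff, Submodule.smul_le]
    intro n hn e _
    exact Subtype.ext ((Submodule.mem_torsionBySet_iff _ _).mp e.2 ⟨n, hn⟩)
  · exact Subtype.ext (hone x (Ideal.mem_span_singleton_self x))
  · intro h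
    have h1 : ι 1 = 0 := congrArg Subtype.val h
    rw [map_eq_zero_iff ι hι, ← map_one (Ideal.Quotient.mk (Ideal.span {x})),
      Ideal.Quotient.eq_zero_iff_mem] at h1
    exact Ideal.span_singleton_eq_top.mp ((Ideal.eq_top_iff_one _).mpr h1)

/-! ### Each condition makes non-nilpotent elements units -/

theorem IsPhiIFRing.isUnit_of_notMem (h : IsPhiIFRing R) {x : R} (hx : x ∉ nilradical R) :
    IsUnit x := by
  obtain ⟨E, _, _, e, hE, hN, he, hu⟩ := exists_isNonnilInjective_killed h.isPhiRing hx
  refine hu ?_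
  have := (h.isPhiFlat E hE).mem_nilradical_smul_top h.isPhiRing hx he
  rwa [hN, Submodule.mem_bot] at this

/-- The annihilator of x lies in the prime N, so a x ↦ a mod N is well defined. -/
theorem exists_linearMap_span_singleton (hR : IsPhiRing R) {x : R} (hx : x ∉ nilradical R) :
    ∃ θ : Ideal.span {x} →ₗ[R] R ⧸ nilradical R,
      θ ⟨x, Ideal.mem_span_singleton_self x⟩ = 1 := by
  let g := LinearMap.toSpanSingleton R (Ideal.span {x}) ⟨x, Ideal.mem_span_singleton_self x⟩
  have hg : Function.Surjective g := by
    rintro ⟨y, hy⟩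
    obtain ⟨a, rfl⟩ := Ideal.mem_span_singleton'.mp hy
    exact ⟨a, rfl⟩
  have hker : LinearMap.ker g ≤ LinearMap.ker (nilradical R).mkQ := by
    intro a ha
    rw [Submodule.ker_mkQ]
    exact hR.mem_of_mul_eq_zero hx (congrArg Subtype.val (LinearMap.mem_ker.mp ha))
  refine ⟨(LinearMap.ker g).liftQ _ hker ∘ₗ (g.quotKerEquivOfSurjective hg).symm, ?_⟩
  have h1 : g 1 = ⟨x, Ideal.mem_span_singleton_self x⟩ := one_smul R _
  rw [← h1, LinearMap.comp_apply]
  have h2 : (g.quotKerEquivOfSurjective hg).symm (g 1) = Submodule.Quotient.mk 1 := by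
    rw [LinearEquiv.symm_apply_eq]; rfl
  exact (congrArg _ h2).trans rfl

theorem isUnit_of_forall_isPhiCopureFlat (hR : IsPhiRing R)
    (h : ∀ (M : Type u) [AddCommGroup M] [Module R M], IsPhiTorsion R M → IsPhiCopureFlat R M)
    {x : R} (hx : x ∉ nilradical R) : IsUnit x := by
  obtain ⟨E, _, _, e, hE, hN, he, hu⟩ := exists_isNonnilInjective_killed hR hx
  obtain ⟨θ, hθ⟩ := exists_linearMap_span_singleton hR hx
  refine hu ?_
  have hinj := (isZero_tor_one_iff E (Submodule.subtype_injective (Ideal.span {x}))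
    (LinearMap.exact_subtype_mkQ (Ideal.span {x})) (Submodule.mkQ_surjective _)).mp
      (h _ (isPhiTorsion_quotient_span_singleton hx) E hE)
  -- Its image in E ⊗ R is `x • e = 0`; applying θ then turns e ⊗ x into the class of e in E/NE = E.
  have h0 : e ⊗ₜ[R] (⟨x, Ideal.mem_span_singleton_self x⟩ : Ideal.span {x}) = 0 := by
    apply hinj
    rw [LinearMap.lTensor_tmul, map_zero]
    change e ⊗ₜ[R] x = 0
    rw [← mul_one x, ← smul_eq_mul, ← TensorProduct.smul_tmul, he, TensorProduct.zero_tmul]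
  have h1 := congrArg (TensorProduct.tensorQuotEquivQuotSMul E (nilradical R))
    (congrArg (LinearMap.lTensor E θ) h0)
  rw [LinearMap.lTensor_tmul, hθ, map_zero, map_zero,
    ← map_one (Ideal.Quotient.mk (nilradical R)), TensorProduct.tensorQuotEquivQuotSMul_tmul_mk,
    one_smul] at h1
  have h2 := (Submodule.Quotient.mk_eq_zero _).mp h1
  rwa [hN, Submodule.mem_bot] at h2

theorem isUnit_of_forall_exists_isPhiEmbedding (hR : IsPhiRing R)
    (h : ∀ (M : Type u) [AddCommGroup M] [Module R M],
      ∃ (F : Type u) (_ : AddCommGroup F) (_ : Module R F) (f : M →ₗ[R] F),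
        IsPhiFlat R F ∧ IsPhiEmbedding f)
    {x : R} (hx : x ∉ nilradical R) : IsUnit x := by
  obtain ⟨F, _, _, f, hF, hf⟩ := h (R ⧸ Ideal.span {x})
  -- F is an extension of a `φ`-torsion module by R/(x), hence `φ`-torsion, so N·F = 0.
  have hT : IsPhiTorsion R F := by
    rw [isPhiTorsion_iff]
    intro m
    obtain ⟨s, hs, hsm⟩ := isPhiTorsion_iff.mp hf.isPhiTorsion (Submodule.Quotient.mk m)
    obtain ⟨y, hy⟩ : s • m ∈ LinearMap.range f :=
      (Submodule.Quotient.mk_eq_zero _).mp hsm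
    obtain ⟨t, ht, hty⟩ := isPhiTorsion_iff.mp (isPhiTorsion_quotient_span_singleton hx) y
    refine ⟨t * s, fun hts => (hR.isPrime.mem_or_mem hts).elim ht hs, ?_⟩
    rw [mul_smul, ← hy, ← map_smul, hty, map_zero]
  have hx0 : x • f 1 = 0 := by
    rw [← map_smul, Algebra.smul_def, mul_one, Ideal.Quotient.algebraMap_eq,
      Ideal.Quotient.eq_zero_iff_mem.mpr (Ideal.mem_span_singleton_self x), map_zero]
  have h1 := hF.mem_nilradical_smul_top hR hx hx0
  rw [hT.nilradical_smul_top hR, Submodule.mem_bot, map_eq_zero_iff f hf.injective,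
    ← map_one (Ideal.Quotient.mk (Ideal.span {x})), Ideal.Quotient.eq_zero_iff_mem] at h1
  exact Ideal.span_singleton_eq_top.mp ((Ideal.eq_top_iff_one _).mpr h1)

theorem isPhiFlat_quotient_nilradical (hR : IsPhiRing R) : IsPhiFlat R (R ⧸ nilradical R) := by
  intro T _ _ hT
  rw [isZero_tor_one_iff T (Submodule.subtype_injective (nilradical R))
    (LinearMap.exact_subtype_mkQ (nilradical R)) (Submodule.mkQ_surjective _),
    injective_iff_map_eq_zero]
  intro z hz
  -- All of T ⊗ N vanishes: t ⊗ n = (s • t) ⊗ m = 0 when s kills t and n = sm.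
  clear hz
  induction z with
  | zero => rfl
  | add a b ha hb => rw [ha, hb, add_zero]
  | tmul t n =>
    obtain ⟨s, hs, hst⟩ := isPhiTorsion_iff.mp hT t
    obtain ⟨m, hm, hnm⟩ := hR.exists_eq_mul hs n.2
    have : n = s • (⟨m, hm⟩ : nilradical R) := Subtype.ext hnm
    rw [this, ← TensorProduct.smul_tmul, hst, TensorProduct.zero_tmul]

theorem isUnit_of_isPhiFlat_imp_isNonnilFPInjective (hR : IsPhiRing R)
    (h : ∀ (M : Type u) [AddCommGroup M] [Module R M], IsPhiFlat R M → IsNonnilFPInjective R M)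
    {x : R} (hx : x ∉ nilradical R) : IsUnit x := by
  obtain ⟨θ, hθ⟩ := exists_linearMap_span_singleton hR hx
  have hfp : Module.FinitePresentation R (R ⧸ Ideal.span {x}) :=
    Module.finitePresentation_of_surjective (Submodule.mkQ (Ideal.span {x}))
      (Submodule.mkQ_surjective _) (by
        rw [Submodule.ker_mkQ]; exact Submodule.fg_span_singleton x)
  obtain ⟨g, hg⟩ := exists_extension_of_subsingleton_ext
    (Submodule.subtype_injective (Ideal.span {x})) (LinearMap.exact_subtype_mkQ (Ideal.span {x}))
    (Submodule.mkQ_surjective _) (R ⧸ nilradical R)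
    (h _ (isPhiFlat_quotient_nilradical hR) _ hfp (isPhiTorsion_quotient_span_singleton hx)) θ
  -- An extension of θ to R makes x invertible modulo N, hence invertible.
  have h1 : g x = 1 := (LinearMap.congr_fun hg ⟨x, Ideal.mem_span_singleton_self x⟩).trans hθ
  obtain ⟨c, hc⟩ := Ideal.Quotient.mk_surjective (g 1)
  have h2 : Ideal.Quotient.mk (nilradical R) (x * c) = 1 := by
    rw [map_mul, hc, ← h1]
    conv_rhs => rw [← mul_one x, ← smul_eq_mul, map_smul, Algebra.smul_def]
    rfl
  rw [← map_one (Ideal.Quotient.mk (nilradical R)), Ideal.Quotient.mk_eq_mk_iff_sub_mem,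
    mem_nilradical] at h2
  have h3 : IsUnit (x * c) := by
    have := h2.isUnit_add_one
    rwa [sub_add_cancel] at this
  exact isUnit_of_mul_isUnit_left h3

end PhiRing

/-! ### Rings whose elements are nilpotent or units -/

section NilpotentOrUnit

variable {R : Type u} [CommRing R]

theorem isField_quotient_nilradical_iff (hR : IsPhiRing R) :
    IsField (R ⧸ nilradical R) ↔ ∀ x : R, x ∉ nilradical R → IsUnit x := by
  rw [← Ideal.Quotient.maximal_ideal_iff_isField_quotient]
  constructor
  · intro hmax x hx
    exact Ideal.span_singleton_eq_top.mp (hmax.out.2 _ (hR.divided x hx))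
  · intro h
    refine ⟨⟨hR.isPrime.ne_top, fun J hJ => ?_⟩⟩
    obtain ⟨x, hxJ, hxN⟩ := SetLike.exists_of_lt hJ
    exact Ideal.eq_top_of_isUnit_mem J hxJ (h x hxN)

theorem isPhiRing_of_forall_isUnit [Nontrivial R]
    (h : ∀ x : R, x ∉ nilradical R → IsUnit x) : IsPhiRing R := by
  have hne : nilradical R ≠ ⊤ := fun htop => by
    have h1 : (1 : R) ∈ nilradical R := htop ▸ trivial
    exact not_isNilpotent_one (mem_nilradical.mp h1)
  refine ⟨⟨hne, fun {x y} hxy => or_iff_not_imp_left.mpr fun hx => ?_⟩, fun x hx => ?_⟩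
  · exact (Ideal.unit_mul_mem_iff_mem _ (h x hx)).mp hxy
  · rw [Ideal.span_singleton_eq_top.mpr (h x hx)]
    exact hne.lt_top

theorem IsPhiTorsion.subsingleton_of_forall_isUnit (h : ∀ x : R, x ∉ nilradical R → IsUnit x)
    {T : Type u} [AddCommGroup T] [Module R T] (hT : IsPhiTorsion R T) : Subsingleton T := by
  refine subsingleton_of_forall_eq 0 fun t => ?_
  obtain ⟨s, hs, hst⟩ := isPhiTorsion_iff.mp hT t
  exact (h s hs).smul_eq_zero.mp hst

theorem isPhiFlat_of_forall_isUnit (h : ∀ x : R, x ∉ nilradical R → IsUnit x)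
    (M : Type u) [AddCommGroup M] [Module R M] : IsPhiFlat R M := by
  intro T _ _ hT
  have := hT.subsingleton_of_forall_isUnit h
  let q : (M →₀ R) →ₗ[R] M := Finsupp.linearCombination R id
  rw [isZero_tor_one_iff T (K := LinearMap.ker q) (P := M →₀ R)
    (LinearMap.ker q).subtype_injective
    (LinearMap.exact_subtype_ker_map q) (Finsupp.linearCombination_id_surjective R M)]
  exact Function.injective_of_subsingleton _

theorem isNonnilFPInjective_of_forall_isUnit (h : ∀ x : R, x ∉ nilradical R → IsUnit x)
    (M : Type u) [AddCommGroup M] [Module R M] : IsNonnilFPInjective R M := by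
  intro T _ _ _ hT
  have := hT.subsingleton_of_forall_isUnit h
  -- T is zero, so T → T → T with identity maps is a projective presentation of it.
  exact subsingleton_ext_of_exists_extension (i := LinearMap.id (R := R) (M := T))
    (q := LinearMap.id) Function.injective_id
    (fun y => ⟨fun _ => ⟨y, rfl⟩, fun _ => Subsingleton.elim _ _⟩) Function.surjective_id M
    fun f => ⟨f, rfl⟩

theorem IsPhiTorsion.isPhiCopureFlat_of_forall_isUnit
    (h : ∀ x : R, x ∉ nilradical R → IsUnit x) {T : Type u} [AddCommGroup T] [Module R T]
    (hT : IsPhiTorsion R T) : IsPhiCopureFlat R T := by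
  intro E _ _ _
  have := hT.subsingleton_of_forall_isUnit h
  rw [isZero_tor_one_iff E (i := LinearMap.id (R := R) (M := T)) (q := LinearMap.id)
    Function.injective_id (fun y => ⟨fun _ => ⟨y, rfl⟩, fun _ => Subsingleton.elim _ _⟩)
    Function.surjective_id, LinearMap.lTensor_id]
  exact Function.injective_id

theorem isNonnilCoherent_of_forall_isUnit (hR : IsPhiRing R)
    (h : ∀ x : R, x ∉ nilradical R → IsUnit x) : IsNonnilCoherent R := by
  refine ⟨hR, fun I hI _ => ?_⟩
  obtain ⟨x, hxI, hxN⟩ := SetLike.not_le_iff_exists.mp hI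
  obtain rfl := Ideal.eq_top_of_isUnit_mem I hxI (h x hxN)
  exact Module.FinitePresentation.of_equiv (Submodule.topEquiv (R := R) (M := R)).symm

theorem isPhiIFRing_localization_of_forall_isUnit (h : ∀ x : R, x ∉ nilradical R → IsUnit x)
    (p : Ideal R) [p.IsPrime] : IsPhiIFRing (Localization.AtPrime p) := by
  have hloc : ∀ y : Localization.AtPrime p, y ∉ nilradical _ → IsUnit y := by
    intro y hy
    obtain ⟨r, s, rfl⟩ := IsLocalization.exists_mk'_eq p.primeCompl y
    by_cases hr : r ∈ nilradical R
    · refine absurd ?_ hy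
      rw [IsLocalization.mk'_eq_mul_mk'_one]
      exact Ideal.mul_mem_right _ _
        (mem_nilradical.mpr ((mem_nilradical.mp hr).map (algebraMap R _)))
    · rw [IsLocalization.mk'_eq_mul_mk'_one]
      refine ((h r hr).map (algebraMap R (Localization.AtPrime p))).mul
        (IsUnit.of_mul_eq_one (algebraMap R _ s) ?_)
      rw [IsLocalization.mk'_spec, map_one]
  exact ⟨isPhiRing_of_forall_isUnit hloc, fun M _ _ _ => isPhiFlat_of_forall_isUnit hloc M⟩

theorem isUnit_of_forall_isPhiIFRing_localization (hR : IsPhiRing R)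
    (h : ∀ (m : Ideal R) [m.IsMaximal], IsPhiIFRing (Localization.AtPrime m))
    {x : R} (hx : x ∉ nilradical R) : IsUnit x := by
  by_contra hxu
  obtain ⟨m, hm, hxm⟩ := exists_max_ideal_of_mem_nonunits hxu
  -- x lies in m, so it is not a unit in the localization and must be nilpotent there.
  have hnil : algebraMap R (Localization.AtPrime m) x ∈ nilradical _ := by
    by_contra hxn
    exact (IsLocalization.AtPrime.isUnit_to_map_iff _ m x).mp ((h m).isUnit_of_notMem hxn) hxm
  obtain ⟨k, hk⟩ := mem_nilradical.mp hnil
  rw [← map_pow, IsLocalization.map_eq_zero_iff m.primeCompl] at hk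
  obtain ⟨s, hs⟩ := hk
  have hsx : (s : R) * x ^ k ∈ nilradical R := hs ▸ Ideal.zero_mem _
  rcases hR.isPrime.mem_or_mem hsx with h1 | h1
  · exact s.2 (nilradical_le_prime m h1)
  · exact hx (hR.isPrime.mem_of_pow_mem k h1)

end NilpotentOrUnit

theorem mainTheorem1 (R : Type u) [CommRing R] (hR : IsPhiRing R) :
    List.TFAE [
      IsPhiIFRing R,
      IsNonnilCoherent R ∧
        ∀ (p : Ideal R) [p.IsPrime], IsPhiIFRing (Localization.AtPrime p),
      IsNonnilCoherent R ∧
        ∀ (m : Ideal R) [m.IsMaximal], IsPhiIFRing (Localization.AtPrime m),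
      ∀ (M : Type u) [AddCommGroup M] [Module R M],
        ∃ (F : Type u) (_ : AddCommGroup F) (_ : Module R F) (f : M →ₗ[R] F),
          IsPhiFlat R F ∧ IsPhiEmbedding f,
      ∀ (M : Type u) [AddCommGroup M] [Module R M], IsNonnilFPInjective R M → IsPhiFlat R M,
      IsNonnilCoherent R ∧
        ∀ (M : Type u) [AddCommGroup M] [Module R M], IsPhiFlat R M → IsNonnilFPInjective R M,
      ∀ (M : Type u) [AddCommGroup M] [Module R M], IsPhiFlat R M ↔ IsNonnilFPInjective R M,
      ∀ (M : Type u) [AddCommGroup M] [Module R M], IsPhiTorsion R M → IsPhiCopureFlat R M,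
      IsField (R ⧸ nilradical R)] := by
  rw [isField_quotient_nilradical_iff hR]
  tfae_have 9 → 2 := fun h => ⟨isNonnilCoherent_of_forall_isUnit hR h,
    fun p _ => isPhiIFRing_localization_of_forall_isUnit h p⟩
  tfae_have 2 → 3 := fun h => ⟨h.1, fun m _ => h.2 m⟩
  tfae_have 3 → 9 := fun h _ hx => isUnit_of_forall_isPhiIFRing_localization hR h.2 hx
  tfae_have 9 → 7 := fun h M _ _ => iff_of_true (isPhiFlat_of_forall_isUnit h M)
    (isNonnilFPInjective_of_forall_isUnit h M)
  tfae_have 7 → 5 := fun h M _ _ => (h M).mpr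
  tfae_have 5 → 1 := fun h => ⟨hR, fun M _ _ hM => h M fun T _ _ _ hT => hM T hT⟩
  tfae_have 1 → 9 := fun h _ hx => h.isUnit_of_notMem hx
  tfae_have 9 → 6 := fun h => ⟨isNonnilCoherent_of_forall_isUnit hR h,
    fun M _ _ _ => isNonnilFPInjective_of_forall_isUnit h M⟩
  tfae_have 6 → 9 := fun h _ hx => isUnit_of_isPhiFlat_imp_isNonnilFPInjective hR h.2 hx
  tfae_have 9 → 8 := fun h M _ _ hM => hM.isPhiCopureFlat_of_forall_isUnit h
  tfae_have 8 → 9 := fun h _ hx => isUnit_of_forall_isPhiCopureFlat hR h hx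
  tfae_have 9 → 4 := by
    intro h M _ _
    refine ⟨M, inferInstance, inferInstance, LinearMap.id, isPhiFlat_of_forall_isUnit h M,
      Function.injective_id, isPhiTorsion_iff.mpr fun m => ⟨1, ?_, ?_⟩⟩
    · exact (Ideal.ne_top_iff_one _).mp hR.isPrime.ne_top
    · obtain ⟨m, rfl⟩ := Submodule.mkQ_surjective _ m
      rw [one_smul]
      exact (Submodule.Quotient.mk_eq_zero _).mpr ⟨m, rfl⟩
  tfae_have 4 → 9 := fun h _ hx => isUnit_of_forall_exists_isPhiEmbedding hR h hx
  tfae_finish
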